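/- Let $\mathsf X\subset\mathbb R^d$ be open, $K\subset\mathsf X$ nonempty, compact and convex, and let $f:\mathsf X\to\mathbb R$ be locally Lipschitz. For $x\in\mathsf X$ and $h\in\mathbb R^d$ let $$f^0(x,h)=\limsup_{y\to x,\ \lambda\downarrow 0}\frac{f(y+\lambda h)-f(y)}{\lambda},\qquad \bar\partial f(x)=\{\zeta\in\mathbb R^d:\ \langle h,\zeta\rangle\le f^0(x,h)\ \text{ for all } h\in\mathbb R^d\}$$ be the generalized directional derivative and the Clarke generalized gradient. Assume that $f$ is regular on $\mathsf X$, i.e. for all $x\in\mathsf X$ and $h\in\mathbb R^d$ the limit $\lim_{\lambda\downarrow0}(f(x+\lambda h)-f(x))/\lambda$ exists and equals $f^0(x,h)$. For $x\in K$ let $N_K(x)=\{g\in\mathbb R^d:\ \langle g,z-x\rangle\le 0\ \text{ for all } z\in K\}$ be the normal cone, let $\Pi_K$ be the Euclidean projection onto $K$, and set $$\mathcal S=\{x\in K:\ 0\in-\bar\partial f(x)-N_K(x)\}.$$ Let $(\gamma_k)_{k\ge1}$ satisfy $\gamma_k>0$, $\sum_{k\ge1}\gamma_k=\infty$ and $\gamma_k\to0$.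 Let $(\delta_k)_{k\ge1}$ be a sequence in $\mathbb R^d$ with $\sup_{k\ge1}\|\delta_k\|<\infty$ that can be written as $\delta_k=e_k+r_k$, where $\|r_k\|\to0$ and the series $\sum_{k\ge1}\gamma_k e_k$ converges. Let $x_0\in\mathsf X$ and, for $k\ge1$, $$x_k=\Pi_K(x_{k-1}-\gamma_kY_k),\qquad Y_k=v_k+\delta_k,\quad v_k\in\bar\partial f(x_{k-1}).$$ **Theorem.** If $f(\mathcal S)$ has empty interior in $\mathbb R$, then $(x_k)$ converges to $\mathcal S$, i.e. $\mathcal S\neq\emptyset$ and $\lim_{k\to\infty}\operatorname{dist}(x_k,\mathcal S)=0$. -/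

import Mathlib

open Filter Topology
open scoped Pointwise

section

variable {E : Type*} [NormedAddCommGroup E] [InnerProductSpace ℝ E]

/-- Clarke's generalized directional derivative
`f⁰(x; h) = limsup_{y → x, t ↓ 0} (f (y + t h) - f y) / t`.
Only the values of `f` near `x` matter; for `f` Lipschitz near `x` the quotients are bounded, so
that the `limsup` in `ℝ` is the genuine one. -/
noncomputable def clarkeDirDeriv (f : E → ℝ) (x h : E) : ℝ :=
  limsup (fun p : E × ℝ => (f (p.1 + p.2 • h) - f p.1) / p.2) (𝓝 x ×ˢ 𝓝[>] (0 : ℝ))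

/-- The Clarke generalized gradient of `f` at `x`. -/
def clarkeGradient (f : E → ℝ) (x : E) : Set E :=
  {ζ | ∀ h : E, inner ℝ h ζ ≤ clarkeDirDeriv f x h}

/-- `f` is (Clarke) regular at `x`: all one-sided directional derivatives exist and coincide with
the generalized ones. -/
def IsClarkeRegularAt (f : E → ℝ) (x : E) : Prop :=
  ∀ h : E, Tendsto (fun t : ℝ => (f (x + t • h) - f x) / t) (𝓝[>] (0 : ℝ))
    (𝓝 (clarkeDirDeriv f x h))

/-- The normal cone to `K` at `x`. -/
def normalConeAt (K : Set E) (x : E) : Set E :=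
  {g | ∀ z ∈ K, inner ℝ g (z - x) ≤ 0}

/-- `p` is a Euclidean projection of `w` onto `K`, i.e. a point of `K` nearest to `w`. For a
nonempty closed convex `K` in a complete space there is exactly one, so this says `p = Π_K(w)`. -/
def IsProjectionOnto (K : Set E) (w p : E) : Prop :=
  p ∈ K ∧ ∀ z ∈ K, ‖w - p‖ ≤ ‖w - z‖

/-- The stationary points of `f` on `K`: those `x ∈ K` with `0 ∈ -∂̄f(x) - N_K(x)`. -/
def stationarySet (f : E → ℝ) (K : Set E) : Set E :=
  {x | x ∈ K ∧ (0 : E) ∈ -clarkeGradient f x - normalConeAt K x}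

end

/-! The iteration is a discretization of `y' ∈ -∂̄f(y) - N_K(y)`, with the projection residual
divided by the step as normal vector. Sums over windows of fixed duration converge along an
ultrafilter to Lipschitz curves `V`, `H`; the noise vanishes in the limit, and `y = p - V - H`
solves the inclusion (`mem_clarkeGradient_of_hasDerivAt`, `mem_normalConeAt_of_hasDerivAt`).
Regularity makes `f` a strict Lyapunov function off the stationary set
(`lt_of_not_mem_stationarySet`).

Hence `f (x n)` cannot pass infinitely often from below a nonstationary value `c` to above some `d >
c`: at the last indices below `c`, a limit point would have value `c`, and the flow from it would go
below `c` while the iterates are still above it (`not_frequently_upcrossing`). A nonstationary limit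
point `p` would flow to a limit point `q` with `f q < f p`. Empty interior supplies a nonstationary
value strictly between the two, so such passages would recur forever. -/

/-! ### Clarke calculus and descent along trajectories -/

section ClarkeCalculus

open scoped NNReal

variable {E : Type*} [NormedAddCommGroup E] [InnerProductSpace ℝ E]

/-- The difference quotients defining the Clarke derivative are bounded near a point around which
`f` is Lipschitz. -/
lemma eventually_abs_clarkeQuotient_le {f : E → ℝ} {x : E} {L : ℝ≥0} {s : Set E}
    (hs : s ∈ 𝓝 x) (hf : LipschitzOnWith L f s) (h : E) :
    ∀ᶠ p : E × ℝ in 𝓝 x ×ˢ 𝓝[>] (0 : ℝ), |(f (p.1 + p.2 • h) - f p.1) / p.2| ≤ L * ‖h‖ := by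
  have h1 : Tendsto (fun p : E × ℝ => p.1 + p.2 • h) (𝓝 x ×ˢ 𝓝[>] (0 : ℝ)) (𝓝 x) := by
    have h2 : Tendsto (fun p : E × ℝ => p.1 + p.2 • h) (𝓝 (x, (0 : ℝ))) (𝓝 x) :=
      Continuous.tendsto' (by fun_prop) _ _ (by simp)
    refine h2.mono_left ?_
    rw [nhds_prod_eq]
    exact Filter.prod_mono le_rfl nhdsWithin_le_nhds
  filter_upwards [h1 hs, tendsto_fst hs, tendsto_snd self_mem_nhdsWithin] with p hp1 hp2 hp3
  have hp3 : 0 < p.2 := hp3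
  have h4 := hf.dist_le_mul _ hp1 _ hp2
  rw [Real.dist_eq, dist_eq_norm, add_sub_cancel_left, norm_smul, Real.norm_of_nonneg hp3.le] at h4
  rw [abs_div, abs_of_pos hp3, div_le_iff₀ hp3]
  linarith

lemma isBoundedUnder_le_clarkeQuotient {f : E → ℝ} {x : E} {L : ℝ≥0} {s : Set E}
    (hs : s ∈ 𝓝 x) (hf : LipschitzOnWith L f s) (h : E) :
    IsBoundedUnder (· ≤ ·) (𝓝 x ×ˢ 𝓝[>] (0 : ℝ))
      (fun p : E × ℝ => (f (p.1 + p.2 • h) - f p.1) / p.2) :=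
  ⟨L * ‖h‖, eventually_map.2 <|
    (eventually_abs_clarkeQuotient_le hs hf h).mono fun _ hp => (abs_le.1 hp).2⟩

lemma isCoboundedUnder_le_clarkeQuotient {f : E → ℝ} {x : E} {L : ℝ≥0} {s : Set E}
    (hs : s ∈ 𝓝 x) (hf : LipschitzOnWith L f s) (h : E) :
    IsCoboundedUnder (· ≤ ·) (𝓝 x ×ˢ 𝓝[>] (0 : ℝ))
      (fun p : E × ℝ => (f (p.1 + p.2 • h) - f p.1) / p.2) := by
  refine IsBoundedUnder.isCoboundedUnder_le ⟨-(L * ‖h‖), eventually_map.2 ?_⟩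
  exact (eventually_abs_clarkeQuotient_le hs hf h).mono fun _ hp => (abs_le.1 hp).1

lemma clarkeDirDeriv_le {f : E → ℝ} {x : E} {L : ℝ≥0} {s : Set E}
    (hs : s ∈ 𝓝 x) (hf : LipschitzOnWith L f s) (h : E) :
    clarkeDirDeriv f x h ≤ L * ‖h‖ :=
  limsup_le_of_le (isCoboundedUnder_le_clarkeQuotient hs hf h) <|
    (eventually_abs_clarkeQuotient_le hs hf h).mono fun _ hp => (abs_le.1 hp).2

/-- The Clarke derivative is upper semicontinuous in the base point. -/
lemma eventually_clarkeDirDeriv_le {f : E → ℝ} {x : E} {L : ℝ≥0} {s : Set E}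
    (hs : s ∈ 𝓝 x) (hf : LipschitzOnWith L f s) (h : E) {c : ℝ} (hc : clarkeDirDeriv f x h < c) :
    ∀ᶠ y in 𝓝 x, clarkeDirDeriv f y h ≤ c := by
  have h1 := eventually_lt_of_limsup_lt hc (isBoundedUnder_le_clarkeQuotient hs hf h)
  obtain ⟨pa, hpa, pb, hpb, hab⟩ := eventually_prod_iff.1 h1
  filter_upwards [eventually_eventually_nhds.2 hpa, eventually_mem_nhds_iff.2 hs] with y hy hys
  refine limsup_le_of_le (isCoboundedUnder_le_clarkeQuotient hys hf h) ?_
  exact eventually_prod_iff.2 ⟨pa, hy, pb, hpb, fun hx _ hy => (hab hx hy).le⟩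

lemma norm_le_of_mem_clarkeGradient {f : E → ℝ} {x ζ : E} {L : ℝ≥0} {s : Set E}
    (hs : s ∈ 𝓝 x) (hf : LipschitzOnWith L f s) (hζ : ζ ∈ clarkeGradient f x) : ‖ζ‖ ≤ L := by
  have h1 : ‖ζ‖ * ‖ζ‖ ≤ L * ‖ζ‖ := by
    rw [← real_inner_self_eq_norm_mul_norm]
    exact (hζ ζ).trans (clarkeDirDeriv_le hs hf ζ)
  rcases (norm_nonneg ζ).eq_or_lt with h0 | h0
  · rw [← h0]; exact L.2
  · exact le_of_mul_le_mul_right h1 h0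

lemma mem_stationarySet_of_add_eq_zero {f : E → ℝ} {K : Set E} {x ζ η : E} (hx : x ∈ K)
    (hζ : ζ ∈ clarkeGradient f x) (hη : η ∈ normalConeAt K x) (h : ζ + η = 0) :
    x ∈ stationarySet f K := by
  refine ⟨hx, Set.mem_sub.2 ⟨-ζ, by simpa using hζ, η, hη, ?_⟩⟩
  rw [← neg_add', h, neg_zero]

/-- The obtuse-angle criterion; it puts the residual `w - p` in the normal cone at `p`. -/
lemma IsProjectionOnto.inner_le_zero {K : Set E} (hK : Convex ℝ K) {w p : E}
    (hp : IsProjectionOnto K w p) {z : E} (hz : z ∈ K) : inner ℝ (w - p) (z - p) ≤ 0 := by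
  refine (norm_eq_iInf_iff_real_inner_le_zero hK hp.1).1 (le_antisymm ?_ ?_) z hz
  · have : Nonempty K := ⟨⟨p, hp.1⟩⟩
    exact le_ciInf fun z => hp.2 z z.2
  · exact ciInf_le ⟨0, by rintro _ ⟨y, rfl⟩; exact norm_nonneg _⟩ (⟨p, hp.1⟩ : K)

/-- The Clarke gradients of a locally Lipschitz function are uniformly bounded on compact sets. -/
lemma exists_bound_clarkeGradient {f : E → ℝ} {X K : Set E} (hX : IsOpen X) (hKX : K ⊆ X)
    (hK : IsCompact K) (hf : LocallyLipschitzOn X f) :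
    ∃ M : ℝ, ∀ x ∈ K, ∀ ζ ∈ clarkeGradient f x, ‖ζ‖ ≤ M := by
  refine hK.induction_on (p := fun s => ∃ M : ℝ, ∀ x ∈ s, ∀ ζ ∈ clarkeGradient f x, ‖ζ‖ ≤ M)
    ⟨0, by simp⟩ ?_ ?_ ?_
  · rintro s t hst ⟨M, hM⟩
    exact ⟨M, fun x hx => hM x (hst hx)⟩
  · rintro s t ⟨M, hM⟩ ⟨N, hN⟩
    refine ⟨max M N, ?_⟩
    rintro x (hx | hx) ζ hζ
    · exact (hM x hx ζ hζ).trans (le_max_left _ _)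
    · exact (hN x hx ζ hζ).trans (le_max_right _ _)
  · intro x hx
    obtain ⟨L, s, hs, hL⟩ := hf (hKX hx)
    rw [hX.nhdsWithin_eq (hKX hx)] at hs
    exact ⟨_, nhdsWithin_le_nhds (eventually_mem_nhds_iff.2 hs), L, fun y hy ζ hζ =>
      norm_le_of_mem_clarkeGradient hy hL hζ⟩

/-- A Lipschitz function whose derivative is almost everywhere nonpositive does not increase. -/
lemma LipschitzWith.le_of_ae_hasDerivAt_nonpos {φ : ℝ → ℝ} {L : ℝ≥0} (hφ : LipschitzWith L φ)
    {a b : ℝ} (hab : a ≤ b)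
    (hd : ∀ᵐ t, a < t → ∀ φ', HasDerivAt φ φ' t → φ' ≤ 0) : φ b ≤ φ a := by
  have h1 := (hφ.lipschitzOnWith (s := Set.uIcc a b)).absolutelyContinuousOnInterval
    |>.integral_deriv_eq_sub
  have h2 : ∫ t in a..b, deriv φ t ≤ 0 := by
    rw [intervalIntegral.integral_of_le hab]
    refine MeasureTheory.integral_nonpos_of_ae ?_
    filter_upwards [MeasureTheory.ae_restrict_of_ae hd,
      MeasureTheory.ae_restrict_mem measurableSet_Ioc] with t ht hmem
    by_cases hdiff : DifferentiableAt ℝ φ t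
    · exact ht hmem.1 _ hdiff.hasDerivAt
    · simp [deriv_zero_of_not_differentiableAt hdiff]
  linarith

/-- Along a curve whose velocity is `-ζ - η` with `ζ` in the Clarke gradient and `η` in the normal
cone, the derivative of a regular function is at most minus the squared speed. -/
lemma deriv_comp_le_neg_norm_sq {f : E → ℝ} {K : Set E} {y : ℝ → E} {t g' : ℝ} {ζ η : E}
    {L : ℝ≥0} {s : Set E} (hs : s ∈ 𝓝 (y t)) (hf : LipschitzOnWith L f s)
    (hreg : IsClarkeRegularAt f (y t)) (hyK : ∀ r, y r ∈ K)
    (hζ : ζ ∈ clarkeGradient f (y t)) (hη : η ∈ normalConeAt K (y t))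
    (hy : HasDerivAt y (-(ζ + η)) t) (hg : HasDerivAt (fun r => f (y r)) g' t) :
    g' ≤ -‖ζ + η‖ ^ 2 := by
  set u := ζ + η with hu
  -- the reversed curve
  have hrev : HasDerivAt (fun r : ℝ => t - r) (-1) 0 := by
    simpa using (hasDerivAt_id (0 : ℝ)).const_sub t
  have hy' : HasDerivAt (fun r => y (t - r)) u 0 := by
    have := HasDerivAt.scomp (h := fun r : ℝ => t - r) (0 : ℝ) (by simpa using hy) hrev
    simpa [Function.comp_def] using this
  have hg'' : HasDerivAt (fun r => f (y (t - r))) (-g') 0 := by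
    have := HasDerivAt.scomp (h := fun r : ℝ => t - r) (0 : ℝ) (by simpa using hg) hrev
    simpa [Function.comp_def] using this
  have hy1 := hy'.tendsto_slope_zero_right
  have hg1 := hg''.tendsto_slope_zero_right
  simp only [zero_add, sub_zero, smul_eq_mul] at hy1 hg1
  have hinner : inner ℝ η u ≤ 0 := by
    have h1 : Tendsto (fun r : ℝ => inner ℝ η (r⁻¹ • (y (t - r) - y t))) (𝓝[>] 0)
      (𝓝 (inner ℝ η u)) := tendsto_const_nhds.inner hy1
    refine le_of_tendsto h1 ?_
    filter_upwards [self_mem_nhdsWithin] with r hr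
    rw [real_inner_smul_right]
    exact mul_nonpos_of_nonneg_of_nonpos (inv_nonneg.2 (le_of_lt hr)) (hη _ (hyK _))
  have h0 : Tendsto (fun r : ℝ => r) (𝓝[>] (0 : ℝ)) (𝓝 0) := nhdsWithin_le_nhds
  have hmem1 : ∀ᶠ r in 𝓝[>] (0 : ℝ), y (t - r) ∈ s := by
    have : Tendsto (fun r : ℝ => y (t - r)) (𝓝[>] (0 : ℝ)) (𝓝 (y t)) := by
      have := hy'.continuousAt.tendsto.comp h0
      simpa [Function.comp_def] using this
    exact this hs
  have hmem2 : ∀ᶠ r in 𝓝[>] (0 : ℝ), y t + r • u ∈ s := by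
    have : Tendsto (fun r : ℝ => y t + r • u) (𝓝[>] (0 : ℝ)) (𝓝 (y t)) := by
      have h2 : Tendsto (fun r : ℝ => y t + r • u) (𝓝 (0 : ℝ)) (𝓝 (y t)) :=
        Continuous.tendsto' (by fun_prop) _ _ (by simp)
      exact h2.mono_left nhdsWithin_le_nhds
    exact this hs
  -- The Lipschitz bound lets the curve be replaced by its tangent ray, the only kind of path that
  -- regularity speaks of.
  have hdiff : Tendsto (fun r : ℝ => r⁻¹ * (f (y (t - r)) - f (y t + r • u))) (𝓝[>] 0) (𝓝 0) := by
    have h2 : Tendsto (fun r : ℝ => (L : ℝ) * ‖r⁻¹ • (y (t - r) - y t) - u‖) (𝓝[>] 0) (𝓝 0) := by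
      have := ((hy1.sub_const u).norm).const_mul (L : ℝ)
      simpa using this
    refine squeeze_zero_norm' ?_ h2
    filter_upwards [hmem1, hmem2, self_mem_nhdsWithin] with r h3 h4 hr
    have hr : 0 < r := hr
    have h5 := hf.dist_le_mul _ h3 _ h4
    rw [Real.dist_eq, dist_eq_norm] at h5
    have h6 : y (t - r) - (y t + r • u) = r • (r⁻¹ • (y (t - r) - y t) - u) := by
      rw [smul_sub, smul_inv_smul₀ hr.ne']; abel
    rw [h6, norm_smul, Real.norm_of_nonneg hr.le] at h5
    rw [norm_mul, norm_inv, Real.norm_of_nonneg hr.le, Real.norm_eq_abs, inv_mul_le_iff₀ hr]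
    linarith
  -- Time reversal matters here: `⟪u, ζ⟫ ≤ f⁰(y t; u) = -g'` bounds `g'` from above, whereas the
  -- forward direction `-u` would bound it from below.
  have heq : -g' = clarkeDirDeriv f (y t) u := by
    refine tendsto_nhds_unique ((sub_zero (-g') ▸ hg1.sub hdiff).congr' ?_) (hreg u)
    filter_upwards [self_mem_nhdsWithin] with r hr
    ring
  have h7 := hζ u
  have h8 : inner ℝ u ζ = ‖u‖ ^ 2 - inner ℝ η u := by
    rw [← real_inner_self_eq_norm_sq, hu, real_inner_comm ζ, inner_add_left]
    ring
  linarith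

/-- A descent property of the trajectories of `y' ∈ -∂f(y) - N_K(y)`: a regular `f` strictly
decreases along a trajectory that starts at a nonstationary point. -/
theorem lt_of_not_mem_stationarySet [FiniteDimensional ℝ E] {f : E → ℝ} {X K : Set E}
    (hX : IsOpen X) (hKX : K ⊆ X) (hK : IsCompact K) (hf : LocallyLipschitzOn X f)
    (hreg : ∀ z ∈ X, IsClarkeRegularAt f z)
    {y V H : ℝ → E} {LV LH : ℝ≥0} (hyK : ∀ t, y t ∈ K)
    (hV : LipschitzWith LV V) (hH : LipschitzWith LH H) (hy : ∀ t, y t = y 0 - V t - H t)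
    (hV' : ∀ t, 0 < t → ∀ ζ, HasDerivAt V ζ t → ζ ∈ clarkeGradient f (y t))
    (hH' : ∀ t, 0 < t → ∀ η, HasDerivAt H η t → η ∈ normalConeAt K (y t))
    (h0 : y 0 ∉ stationarySet f K) {τ : ℝ} (hτ : 0 < τ) : f (y τ) < f (y 0) := by
  have hyLip : LipschitzWith (LV + LH) y := by
    refine LipschitzWith.of_dist_le_mul fun a b => ?_
    rw [hy a, hy b, sub_sub, sub_sub, dist_sub_left]
    exact (hV.add hH).dist_le_mul a b
  obtain ⟨L, hL⟩ := (hf.mono hKX).exists_lipschitzOnWith_of_compact hK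
  have hgLip : LipschitzWith (L * (LV + LH)) (fun t => f (y t)) := by
    rw [← lipschitzOnWith_univ] at hyLip ⊢
    exact hL.comp hyLip fun t _ => hyK t
  have hderiv : ∀ t ζ η, HasDerivAt V ζ t → HasDerivAt H η t → HasDerivAt y (-(ζ + η)) t := by
    intro t ζ η h1 h2
    have h3 := (h1.const_sub (y 0)).sub h2
    rw [neg_add']
    exact h3.congr_of_eventuallyEq (Eventually.of_forall hy)
  -- With `u` minus the velocity, the derivative of this function is at most `-‖w + u‖² ≤ 0`. Fixing
  -- `w` linearizes the energy inequality, so the squared speed need not be integrated.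
  have hphi : ∀ (w : E) (σ : ℝ), 0 ≤ σ → ∀ ρ, σ ≤ ρ →
      f (y ρ) + 2 * inner ℝ w (y ρ) - ‖w‖ ^ 2 * ρ ≤
        f (y σ) + 2 * inner ℝ w (y σ) - ‖w‖ ^ 2 * σ := by
    intro w σ hσ ρ hρ
    have hlip : ∃ C : ℝ≥0, LipschitzWith C
        (fun t => f (y t) + 2 * inner ℝ w (y t) - ‖w‖ ^ 2 * t) := by
      have h1 : LipschitzWith _ (fun t => ((2 : ℝ) • innerSL ℝ w) (y t)) :=
        ((2 : ℝ) • innerSL ℝ w : E →L[ℝ] ℝ).lipschitz.comp hyLip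
      have h2 := (ContinuousLinearMap.mul ℝ ℝ (‖w‖ ^ 2)).lipschitz
      exact ⟨_, by simpa using (hgLip.add h1).sub h2⟩
    obtain ⟨C, hC⟩ := hlip
    refine hC.le_of_ae_hasDerivAt_nonpos hρ ?_
    filter_upwards [hV.ae_differentiableAt_real, hH.ae_differentiableAt_real,
      hgLip.ae_differentiableAt_real] with t h1 h2 h3 ht φ' hφ'
    have ht : 0 < t := hσ.trans_lt ht
    have hζ := hV' t ht _ h1.hasDerivAt
    have hη := hH' t ht _ h2.hasDerivAt
    have hy' := hderiv t _ _ h1.hasDerivAt h2.hasDerivAt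
    obtain ⟨N, s, hs, hN⟩ := hf (hKX (hyK t))
    rw [hX.nhdsWithin_eq (hKX (hyK t))] at hs
    have h4 := deriv_comp_le_neg_norm_sq hs hN (hreg _ (hKX (hyK t))) hyK hζ hη hy' h3.hasDerivAt
    set u := deriv V t + deriv H t
    have h5 : HasDerivAt (fun t => f (y t) + 2 * inner ℝ w (y t) - ‖w‖ ^ 2 * t)
        (deriv (fun r => f (y r)) t + 2 * inner ℝ w (-u) - ‖w‖ ^ 2 * 1) t := by
      refine (h3.hasDerivAt.add (HasDerivAt.const_mul 2 ?_)).sub ((hasDerivAt_id t).const_mul _)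
      simpa [Function.comp_def] using (innerSL ℝ w).hasFDerivAt.comp_hasDerivAt t hy'
    rw [hφ'.unique h5, inner_neg_right]
    have h6 := norm_add_sq_real w u
    nlinarith [sq_nonneg ‖w + u‖]
  by_contra! hcon
  have hconst : ∀ σ, 0 < σ → σ ≤ τ → y σ = y 0 := by
    intro σ hσ hστ
    have h1 : f (y 0) ≤ f (y σ) := by
      have := hphi 0 σ hσ.le τ hστ
      simp at this
      linarith
    set D := y σ - y 0 with hD
    -- The mean velocity is the optimal `w`: it yields `σ⁻¹ * ‖D‖ ^ 2 ≤ f (y 0) - f (y σ)`.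
    have h2 := hphi (σ⁻¹ • D) 0 le_rfl σ hσ.le
    have h3 : inner ℝ (σ⁻¹ • D) (y σ) - inner ℝ (σ⁻¹ • D) (y 0) = σ⁻¹ * ‖D‖ ^ 2 := by
      rw [← inner_sub_right, real_inner_smul_left, real_inner_self_eq_norm_sq]
    have h4 : ‖σ⁻¹ • D‖ ^ 2 * σ = σ⁻¹ * ‖D‖ ^ 2 := by
      rw [norm_smul, norm_inv, Real.norm_of_nonneg hσ.le]
      field_simp
    have h5 : σ⁻¹ * ‖D‖ ^ 2 ≤ 0 := by linarith
    have h6 : ‖D‖ ^ 2 ≤ 0 := by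
      by_contra! h
      exact absurd h5 (not_le.2 (mul_pos (inv_pos.2 hσ) h))
    have h7 : ‖D‖ = 0 := by nlinarith [norm_nonneg D]
    exact sub_eq_zero.1 (norm_eq_zero.1 h7)
  -- The curve is constant on `[0, τ]`, so at any time in between where `V` and `H` are
  -- differentiable the two derivatives cancel and `y 0` is stationary.
  obtain ⟨t, ⟨h1, h2⟩, ht0, htτ⟩ : ∃ t, (DifferentiableAt ℝ V t ∧ DifferentiableAt ℝ H t) ∧
      t ∈ Set.Ioo 0 τ := by
    have h1 := hV.ae_differentiableAt_real.and hH.ae_differentiableAt_real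
    exact (MeasureTheory.Measure.dense_of_ae h1).inter_open_nonempty _ isOpen_Ioo
      (Set.nonempty_Ioo.2 hτ) |>.imp fun t ht => ⟨ht.2, ht.1⟩
  have hy' := hderiv t _ _ h1.hasDerivAt h2.hasDerivAt
  have hy0 : HasDerivAt y 0 t := by
    refine (hasDerivAt_const t (y 0)).congr_of_eventuallyEq ?_
    filter_upwards [Ioo_mem_nhds ht0 htτ] with r hr
    exact hconst r hr.1 hr.2.le
  have h3 : deriv V t + deriv H t = 0 := neg_eq_zero.1 (hy'.unique hy0)
  have h4 := mem_stationarySet_of_add_eq_zero (hyK t) (hV' t ht0 _ h1.hasDerivAt)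
    (hH' t ht0 _ h2.hasDerivAt) h3
  rw [hconst t ht0 htτ.le] at h4
  exact h0 h4

end ClarkeCalculus

/-! ### Windows of fixed duration and limit curves -/

section Windows

open scoped NNReal

/-- The time reached after `n` steps of lengths `γ 0, γ 1, …`. -/
def stepTime (γ : ℕ → ℝ) (n : ℕ) : ℝ := ∑ i ∈ Finset.range n, γ i

/-- The first index `k ≥ n` at which at least the time `t` has passed since step `n`. -/
noncomputable def windowEnd (γ : ℕ → ℝ) (n : ℕ) (t : ℝ) : ℕ :=
  sInf {k | n ≤ k ∧ stepTime γ n + t ≤ stepTime γ k}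

variable {γ : ℕ → ℝ}

lemma stepTime_succ (k : ℕ) : stepTime γ (k + 1) = stepTime γ k + γ k :=
  Finset.sum_range_succ _ _

lemma sum_Ico_eq_stepTime_sub {m n : ℕ} (h : m ≤ n) :
    ∑ k ∈ Finset.Ico m n, γ k = stepTime γ n - stepTime γ m :=
  Finset.sum_Ico_eq_sub _ h

lemma stepTime_mono (hγ : ∀ k, 0 < γ k) : Monotone (stepTime γ) :=
  monotone_nat_of_le_succ fun k => by rw [stepTime_succ]; linarith [hγ k]

lemma windowEnd_mem (hsum : Tendsto (stepTime γ) atTop atTop) (n : ℕ) (t : ℝ) :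
    n ≤ windowEnd γ n t ∧ stepTime γ n + t ≤ stepTime γ (windowEnd γ n t) :=
  Nat.sInf_mem (s := {k | n ≤ k ∧ stepTime γ n + t ≤ stepTime γ k})
    ((eventually_ge_atTop n).and (hsum.eventually_ge_atTop _)).exists

lemma stepTime_lt_of_lt_windowEnd {n k : ℕ} {t : ℝ} (hn : n ≤ k) (hk : k < windowEnd γ n t) :
    stepTime γ k < stepTime γ n + t := by
  by_contra! h
  exact Nat.notMem_of_lt_sInf hk ⟨hn, h⟩

lemma windowEnd_of_nonpos {t : ℝ} (ht : t ≤ 0) (n : ℕ) : windowEnd γ n t = n := by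
  refine le_antisymm (Nat.sInf_le ⟨le_rfl, by linarith⟩) ?_
  exact le_csInf ⟨n, le_rfl, by linarith⟩ fun k hk => hk.1

lemma windowEnd_mono (hsum : Tendsto (stepTime γ) atTop atTop) (n : ℕ) :
    Monotone (windowEnd γ n) := fun s t hst =>
  Nat.sInf_le ⟨(windowEnd_mem hsum n t).1, by linarith [(windowEnd_mem hsum n t).2]⟩

lemma tendsto_windowEnd (hsum : Tendsto (stepTime γ) atTop atTop) (t : ℝ) :
    Tendsto (fun n => windowEnd γ n t) atTop atTop :=
  tendsto_atTop_mono (fun n => (windowEnd_mem hsum n t).1) tendsto_id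

lemma tendsto_stepTime_windowEnd_sub (hsum : Tendsto (stepTime γ) atTop atTop)
    (hlim : Tendsto γ atTop (𝓝 0)) (t : ℝ) :
    Tendsto (fun n => stepTime γ (windowEnd γ n t) - stepTime γ n) atTop (𝓝 (max t 0)) := by
  rcases le_or_gt t 0 with ht | ht
  · simp [windowEnd_of_nonpos ht, ht]
  rw [max_eq_left ht.le]
  rw [Metric.tendsto_atTop]
  intro ε hε
  obtain ⟨N, hN⟩ := eventually_atTop.1 (hlim.eventually_lt_const hε)
  refine ⟨N, fun n hn => ?_⟩
  obtain ⟨h1, h2⟩ := windowEnd_mem hsum n t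
  have h3 : n < windowEnd γ n t := by
    refine lt_of_le_of_ne h1 fun h => ?_
    rw [← h] at h2
    linarith
  obtain ⟨m, hm⟩ : ∃ m, windowEnd γ n t = m + 1 := ⟨windowEnd γ n t - 1, by omega⟩
  -- A window overshoots its duration by less than its last step `γ m`.
  have h4 : stepTime γ m < stepTime γ n + t := stepTime_lt_of_lt_windowEnd (by omega) (by omega)
  have h5 := hN m (by omega)
  rw [hm, stepTime_succ] at h2 ⊢
  rw [Real.dist_eq, abs_lt]
  constructor <;> linarith

lemma tendsto_stepTime_windowEnd_sub_windowEnd (hsum : Tendsto (stepTime γ) atTop atTop)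
    (hlim : Tendsto γ atTop (𝓝 0)) (s t : ℝ) :
    Tendsto (fun n => stepTime γ (windowEnd γ n t) - stepTime γ (windowEnd γ n s)) atTop
      (𝓝 (max t 0 - max s 0)) := by
  simpa using (tendsto_stepTime_windowEnd_sub hsum hlim t).sub
    (tendsto_stepTime_windowEnd_sub hsum hlim s)

variable {E : Type*} [NormedAddCommGroup E] [InnerProductSpace ℝ E]

lemma norm_sum_Ico_smul_le (hγ : ∀ k, 0 < γ k) {w : ℕ → E} {C : ℝ} {m n : ℕ} (hmn : m ≤ n)
    (hw : ∀ k ∈ Finset.Ico m n, ‖w k‖ ≤ C) :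
    ‖∑ k ∈ Finset.Ico m n, γ k • w k‖ ≤ C * (stepTime γ n - stepTime γ m) := by
  rw [← sum_Ico_eq_stepTime_sub hmn, Finset.mul_sum]
  refine norm_sum_le_of_le _ fun k hk => ?_
  rw [norm_smul, Real.norm_of_nonneg (hγ k).le, mul_comm]
  exact mul_le_mul_of_nonneg_right (hw k hk) (hγ k).le

lemma inner_sum_Ico_smul_le (hγ : ∀ k, 0 < γ k) {w : ℕ → E} {u : E} {c : ℝ} {m n : ℕ}
    (hmn : m ≤ n) (hw : ∀ k ∈ Finset.Ico m n, inner ℝ u (w k) ≤ c) :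
    inner ℝ u (∑ k ∈ Finset.Ico m n, γ k • w k) ≤ c * (stepTime γ n - stepTime γ m) := by
  rw [← sum_Ico_eq_stepTime_sub hmn, Finset.mul_sum, inner_sum]
  refine Finset.sum_le_sum fun k hk => ?_
  rw [real_inner_smul_right, mul_comm]
  exact mul_le_mul_of_nonneg_right (hw k hk) (hγ k).le

/-- `A` is the limit along `U` of the sums of `γ k • w k` over the windows of duration `t`. -/
def IsLimitCurve (γ : ℕ → ℝ) (w : ℕ → E) (U : Filter ℕ) (A : ℝ → E) : Prop :=
  ∀ t, Tendsto (fun n => ∑ k ∈ Finset.Ico n (windowEnd γ n t), γ k • w k) U (𝓝 (A t))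

lemma IsLimitCurve.tendsto_sub {w : ℕ → E} {U : Filter ℕ} {A : ℝ → E}
    (hsum : Tendsto (stepTime γ) atTop atTop) (hA : IsLimitCurve γ w U A) {s t : ℝ} (hst : s ≤ t) :
    Tendsto (fun n => ∑ k ∈ Finset.Ico (windowEnd γ n s) (windowEnd γ n t), γ k • w k) U
      (𝓝 (A t - A s)) := by
  refine ((hA t).sub (hA s)).congr fun n => ?_
  rw [sub_eq_iff_eq_add', Finset.sum_Ico_consecutive _ (windowEnd_mem hsum n s).1
    (windowEnd_mono hsum n hst)]

lemma IsLimitCurve.map_zero {w : ℕ → E} {U : Filter ℕ} [U.NeBot] {A : ℝ → E}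
    (hA : IsLimitCurve γ w U A) : A 0 = 0 := by
  have h := hA 0
  simp only [windowEnd_of_nonpos le_rfl, Finset.Ico_self, Finset.sum_empty] at h
  exact tendsto_nhds_unique h tendsto_const_nhds

/-- The window sums are eventually bounded, so the ultrafilter has a limit for every `t` at once,
with no extraction of subsequences; the Lipschitz bound passes to the limit. -/
lemma exists_isLimitCurve [FiniteDimensional ℝ E] (hγ : ∀ k, 0 < γ k)
    (hsum : Tendsto (stepTime γ) atTop atTop) (hlim : Tendsto γ atTop (𝓝 0))
    {w : ℕ → E} {C : ℝ≥0} (hw : ∀ k, ‖w k‖ ≤ C) (U : Ultrafilter ℕ) (hU : (U : Filter ℕ) ≤ atTop) :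
    ∃ A : ℝ → E, LipschitzWith C A ∧ IsLimitCurve γ w (U : Filter ℕ) A := by
  have hex : ∀ t : ℝ, ∃ a, Tendsto
      (fun n => ∑ k ∈ Finset.Ico n (windowEnd γ n t), γ k • w k) U (𝓝 a) := by
    intro t
    have h1 := (tendsto_stepTime_windowEnd_sub hsum hlim t).mono_left hU
    have h2 : ∀ᶠ n in (U : Filter ℕ), (∑ k ∈ Finset.Ico n (windowEnd γ n t), γ k • w k) ∈
        Metric.closedBall (0 : E) (C * (max t 0 + 1)) := by
      filter_upwards [h1.eventually_lt_const (lt_add_one _)] with n hn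
      rw [mem_closedBall_zero_iff]
      refine (norm_sum_Ico_smul_le hγ (windowEnd_mem hsum n t).1 fun k _ => hw k).trans ?_
      exact mul_le_mul_of_nonneg_left hn.le C.2
    obtain ⟨a, -, ha⟩ := (ProperSpace.isCompact_closedBall (0 : E) _).ultrafilter_le_nhds
      (U.map fun n => ∑ k ∈ Finset.Ico n (windowEnd γ n t), γ k • w k)
      (le_principal_iff.2 h2)
    exact ⟨a, ha⟩
  choose A hA using hex
  have hA' : IsLimitCurve γ w (U : Filter ℕ) A := hA
  refine ⟨A, ?_, hA'⟩
  have key : ∀ s t, s ≤ t → dist (A t) (A s) ≤ C * dist t s := by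
    intro s t hst
    rw [dist_eq_norm, Real.dist_eq, abs_of_nonneg (sub_nonneg.2 hst)]
    have h1 := ((tendsto_stepTime_windowEnd_sub_windowEnd hsum hlim s t).mono_left hU).const_mul
      (C : ℝ)
    have h2 := le_of_tendsto_of_tendsto (hA'.tendsto_sub hsum hst).norm h1
      (Eventually.of_forall fun n =>
        norm_sum_Ico_smul_le hγ (windowEnd_mono hsum n hst) fun k _ => hw k)
    refine h2.trans (mul_le_mul_of_nonneg_left ?_ C.2)
    rcases max_cases t 0 with h | h <;> rcases max_cases s 0 with h' | h' <;> linarith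
  refine LipschitzWith.of_dist_le_mul fun a b => ?_
  rcases le_total a b with h | h
  · rw [dist_comm, dist_comm a]; exact key a b h
  · exact key b a h

/-- A bound on `⟪u, w k⟫` over short windows passes to the derivative of the limit curve. -/
lemma IsLimitCurve.inner_deriv_le (hγ : ∀ k, 0 < γ k)
    (hsum : Tendsto (stepTime γ) atTop atTop) (hlim : Tendsto γ atTop (𝓝 0))
    {w : ℕ → E} {U : Filter ℕ} [U.NeBot] (hU : U ≤ atTop) {A : ℝ → E} (hA : IsLimitCurve γ w U A)
    {s : ℝ} (hs : 0 < s) {a : E} (ha : HasDerivAt A a s) {u : E} {c : ℝ}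
    (hc : ∀ᶠ t in 𝓝[>] s, ∀ᶠ n in U,
      ∀ k ∈ Finset.Ico (windowEnd γ n s) (windowEnd γ n t), inner ℝ u (w k) ≤ c) :
    inner ℝ u a ≤ c := by
  have h1 : Tendsto (fun t => inner ℝ u (slope A s t)) (𝓝[>] s) (𝓝 (inner ℝ u a)) :=
    tendsto_const_nhds.inner (hasDerivAt_iff_tendsto_slope_left_right.1 ha).2
  refine le_of_tendsto h1 ?_
  filter_upwards [hc, self_mem_nhdsWithin] with t ht hst
  have hst : s < t := hst
  have h2 : inner ℝ u (A t - A s) ≤ c * (t - s) := by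
    have h3 := ((tendsto_stepTime_windowEnd_sub_windowEnd hsum hlim s t).mono_left hU).const_mul c
    rw [max_eq_left hs.le, max_eq_left (hs.trans hst).le] at h3
    refine le_of_tendsto_of_tendsto (tendsto_const_nhds.inner (hA.tendsto_sub hsum hst.le)) h3 ?_
    filter_upwards [ht] with n hn
    exact inner_sum_Ico_smul_le hγ (windowEnd_mono hsum n hst.le) hn
  rw [slope_def_module, real_inner_smul_right, inv_mul_le_iff₀ (sub_pos.2 hst)]
  linarith

lemma norm_sub_le_of_step_le {F : Type*} [SeminormedAddCommGroup F] {x : ℕ → F} {C : ℝ}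
    (hx : ∀ k, ‖x (k + 1) - x k‖ ≤ C * γ k)
    {m n : ℕ} (hmn : m ≤ n) : ‖x n - x m‖ ≤ C * (stepTime γ n - stepTime γ m) := by
  induction n, hmn using Nat.le_induction with
  | base => simp
  | succ k _ ih =>
    have h1 := norm_add_le (x (k + 1) - x k) (x k - x m)
    rw [sub_add_sub_cancel] at h1
    rw [stepTime_succ]
    linarith [hx k]

/-- Between times `s` and `t` the iterates move by at most about `C * (t - s)`. The right end is
included because the normal vector of step `k` lives at `x (k + 1)`. -/
lemma eventually_forall_mem_window {F : Type*} [SeminormedAddCommGroup F] (hγ : ∀ k, 0 < γ k)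
    (hsum : Tendsto (stepTime γ) atTop atTop) (hlim : Tendsto γ atTop (𝓝 0))
    {x : ℕ → F} {C : ℝ} (hC : 0 ≤ C) (hx : ∀ k, ‖x (k + 1) - x k‖ ≤ C * γ k)
    {U : Filter ℕ} (hU : U ≤ atTop) {s : ℝ} (hs : 0 < s) {p : F}
    (hp : Tendsto (fun n => x (windowEnd γ n s)) U (𝓝 p)) {O : Set F} (hO : O ∈ 𝓝 p) :
    ∀ᶠ t in 𝓝[>] s, ∀ᶠ n in U,
      ∀ k ∈ Finset.Icc (windowEnd γ n s) (windowEnd γ n t), x k ∈ O := by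
  obtain ⟨ε, hε, hεO⟩ := Metric.mem_nhds_iff.1 hO
  have h1 : ∀ᶠ t in 𝓝[>] s, C * (t - s) < ε / 2 := by
    have : Tendsto (fun t => C * (t - s)) (𝓝 s) (𝓝 0) := Continuous.tendsto' (by fun_prop) _ _
      (by simp)
    exact (this.mono_left nhdsWithin_le_nhds).eventually_lt_const (half_pos hε)
  filter_upwards [h1, self_mem_nhdsWithin] with t ht hst
  have hst : s < t := hst
  have h3 := ((tendsto_stepTime_windowEnd_sub_windowEnd hsum hlim s t).mono_left hU).const_mul C
  rw [max_eq_left hs.le, max_eq_left (hs.trans hst).le] at h3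
  filter_upwards [h3.eventually_lt_const ht, hp (Metric.ball_mem_nhds p (half_pos hε))]
    with n hn1 hn2 k hk
  rw [Finset.mem_Icc] at hk
  apply hεO
  have h4 := norm_sub_le_of_step_le hx hk.1
  have h5 := mul_le_mul_of_nonneg_left (stepTime_mono hγ hk.2) hC
  have h6 : dist (x (windowEnd γ n s)) p < ε / 2 := hn2
  rw [Metric.mem_ball]
  have h7 := dist_triangle (x k) (x (windowEnd γ n s)) p
  rw [dist_eq_norm (x k) (x (windowEnd γ n s))] at h7
  linarith

/-- A noise that is the sum of one whose weighted series converges and one that vanishes is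
negligible over windows of bounded duration. -/
lemma tendsto_sum_window_noise (hγ : ∀ k, 0 < γ k) (hsum : Tendsto (stepTime γ) atTop atTop)
    (hlim : Tendsto γ atTop (𝓝 0)) {e r : ℕ → E} {S : E}
    (he : Tendsto (fun n => ∑ k ∈ Finset.range n, γ k • e k) atTop (𝓝 S))
    (hr : Tendsto (fun k => ‖r k‖) atTop (𝓝 0)) :
    IsLimitCurve γ (fun k => e k + r k) atTop (fun _ => 0) := by
  intro t
  have h1 : Tendsto (fun n => ∑ k ∈ Finset.Ico n (windowEnd γ n t), γ k • e k) atTop (𝓝 0) := by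
    refine (sub_self S ▸ (he.comp (tendsto_windowEnd hsum t)).sub he).congr fun n => ?_
    exact (Finset.sum_Ico_eq_sub _ (windowEnd_mem hsum n t).1).symm
  have h2 : Tendsto (fun n => ∑ k ∈ Finset.Ico n (windowEnd γ n t), γ k • r k) atTop (𝓝 0) := by
    rw [Metric.tendsto_atTop']
    intro ε hε
    have hT : 0 < max t 0 + 1 := by positivity
    -- The window's duration is eventually below `max t 0 + 1`, so terms smaller than `ε / (max t 0
    -- + 1)` sum to less than `ε`.
    obtain ⟨N, hN⟩ := eventually_atTop.1 (hr.eventually_lt_const (div_pos hε hT))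
    obtain ⟨N', hN'⟩ := eventually_atTop.1
      ((tendsto_stepTime_windowEnd_sub hsum hlim t).eventually_lt_const (lt_add_one _))
    refine ⟨max N N', fun n hn => ?_⟩
    rw [dist_zero_right]
    refine (norm_sum_Ico_smul_le hγ (windowEnd_mem hsum n t).1 (C := ε / (max t 0 + 1))
      fun k hk => (hN k ?_).le).trans_lt ?_
    · have := (Finset.mem_Ico.1 hk).1
      omega
    · have h3 := mul_lt_mul_of_pos_left (hN' n (by omega)) (div_pos hε hT)
      rwa [div_mul_cancel₀ _ hT.ne'] at h3
  simpa [smul_add, Finset.sum_add_distrib] using h1.add h2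

end Windows

/-! ### Asymptotics of the discrete scheme -/

section Scheme

open scoped NNReal

variable {E : Type*} [NormedAddCommGroup E] [InnerProductSpace ℝ E]

/-- A discretization of `y' ∈ -∂f(y) - N_K(y)` with bounded increments and a perturbation `ν` that
is negligible over windows of bounded duration. -/
structure IsSubgradientScheme (f : E → ℝ) (K : Set E) (C : ℝ≥0) (γ : ℕ → ℝ)
    (x v η ν : ℕ → E) : Prop where
  pos : ∀ k, 0 < γ k
  sum : Tendsto (stepTime γ) atTop atTop
  lim : Tendsto γ atTop (𝓝 0)
  mem : ∀ k, x k ∈ K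
  grad : ∀ k, v k ∈ clarkeGradient f (x k)
  normal : ∀ k, η k ∈ normalConeAt K (x (k + 1))
  norm_grad : ∀ k, ‖v k‖ ≤ C
  norm_normal : ∀ k, ‖η k‖ ≤ C
  norm_step : ∀ k, ‖x (k + 1) - x k‖ ≤ C * γ k
  step : ∀ k, x (k + 1) = x k - γ k • (v k + η k + ν k)
  noise : IsLimitCurve γ ν atTop (fun _ => 0)

namespace IsSubgradientScheme

variable {f : E → ℝ} {X K : Set E} {C : ℝ≥0} {γ : ℕ → ℝ} {x v η ν : ℕ → E}

lemma eq_sub_sum (h : IsSubgradientScheme f K C γ x v η ν) {m n : ℕ} (hmn : m ≤ n) :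
    x n = x m - ∑ k ∈ Finset.Ico m n, γ k • v k - ∑ k ∈ Finset.Ico m n, γ k • η k -
      ∑ k ∈ Finset.Ico m n, γ k • ν k := by
  induction n, hmn using Nat.le_induction with
  | base => simp
  | succ k hk ih =>
    rw [h.step, ih, Finset.sum_Ico_succ_top hk, Finset.sum_Ico_succ_top hk,
      Finset.sum_Ico_succ_top hk]
    simp only [smul_add]
    abel

/-- The gradient is an intersection of half-spaces, so one direction `u` can be tested at a time;
upper semicontinuity of `f⁰(·; u)` controls the gradients on a short window near `p`. -/
lemma mem_clarkeGradient_of_hasDerivAt (h : IsSubgradientScheme f K C γ x v η ν)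
    (hX : IsOpen X) (hf : LocallyLipschitzOn X f) {U : Filter ℕ} [U.NeBot] (hU : U ≤ atTop)
    {V : ℝ → E} (hV : IsLimitCurve γ v U V) {s : ℝ} (hs : 0 < s) {p ζ : E} (hpX : p ∈ X)
    (hp : Tendsto (fun n => x (windowEnd γ n s)) U (𝓝 p)) (hζ : HasDerivAt V ζ s) :
    ζ ∈ clarkeGradient f p := by
  intro u
  refine le_of_forall_gt_imp_ge_of_dense fun c hc => ?_
  obtain ⟨L, O, hO, hL⟩ := hf hpX
  rw [hX.nhdsWithin_eq hpX] at hO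
  refine hV.inner_deriv_le h.pos h.sum h.lim hU hs hζ ?_
  filter_upwards [eventually_forall_mem_window h.pos h.sum h.lim C.2 h.norm_step hU hs hp
    (eventually_clarkeDirDeriv_le hO hL u hc)] with t ht
  filter_upwards [ht] with n hn k hk
  exact (h.grad k u).trans (hn k (Finset.Ico_subset_Icc_self hk))

lemma mem_normalConeAt_of_hasDerivAt (h : IsSubgradientScheme f K C γ x v η ν)
    {U : Filter ℕ} [U.NeBot] (hU : U ≤ atTop)
    {H : ℝ → E} (hH : IsLimitCurve γ η U H) {s : ℝ} (hs : 0 < s) {p ξ : E}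
    (hp : Tendsto (fun n => x (windowEnd γ n s)) U (𝓝 p)) (hξ : HasDerivAt H ξ s) :
    ξ ∈ normalConeAt K p := by
  intro z hz
  refine le_of_forall_gt_imp_ge_of_dense fun c hc => ?_
  rw [real_inner_comm]
  refine hH.inner_deriv_le h.pos h.sum h.lim hU hs hξ ?_
  -- Moving the base point of the normal inequality from `x (k + 1)` to `p` costs at most `C * ‖x (k
  -- + 1) - p‖`.
  have hO : {y : E | (C : ℝ) * ‖y - p‖ < c} ∈ 𝓝 p := by
    have : Tendsto (fun y => (C : ℝ) * ‖y - p‖) (𝓝 p) (𝓝 0) :=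
      Continuous.tendsto' (by fun_prop) _ _ (by simp)
    exact this.eventually_lt_const hc
  filter_upwards [eventually_forall_mem_window h.pos h.sum h.lim C.2 h.norm_step hU hs hp hO]
    with t ht
  filter_upwards [ht] with n hn k hk
  have h1 := hn (k + 1) (by rw [Finset.mem_Ico] at hk; rw [Finset.mem_Icc]; omega)
  have h2 := h.normal k z hz
  have h3 : inner ℝ (η k) (x (k + 1) - p) ≤ C * ‖x (k + 1) - p‖ :=
    (real_inner_le_norm _ _).trans
      (mul_le_mul_of_nonneg_right (h.norm_normal k) (norm_nonneg _))
  have h4 : inner ℝ (z - p) (η k) =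
      inner ℝ (η k) (z - x (k + 1)) + inner ℝ (η k) (x (k + 1) - p) := by
    rw [← inner_add_right, sub_add_sub_cancel, real_inner_comm]
  have h5 : (C : ℝ) * ‖x (k + 1) - p‖ < c := h1
  linarith

/-- Starting near a nonstationary point, `f` decreases by a definite amount in a given time. -/
theorem exists_tendsto_windowEnd_lt [FiniteDimensional ℝ E]
    (h : IsSubgradientScheme f K C γ x v η ν)
    (hX : IsOpen X) (hKX : K ⊆ X) (hK : IsCompact K) (hf : LocallyLipschitzOn X f)
    (hreg : ∀ z ∈ X, IsClarkeRegularAt f z) (U : Ultrafilter ℕ) (hU : (U : Filter ℕ) ≤ atTop)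
    {p : E} (hp : Tendsto x U (𝓝 p)) (hpS : p ∉ stationarySet f K) {τ : ℝ} (hτ : 0 < τ) :
    ∃ q ∈ K, Tendsto (fun n => x (windowEnd γ n τ)) U (𝓝 q) ∧ f q < f p := by
  obtain ⟨V, hVL, hV⟩ := exists_isLimitCurve h.pos h.sum h.lim h.norm_grad U hU
  obtain ⟨H, hHL, hH⟩ := exists_isLimitCurve h.pos h.sum h.lim h.norm_normal U hU
  have hy : ∀ t, Tendsto (fun n => x (windowEnd γ n t)) U (𝓝 (p - V t - H t)) := by
    intro t
    have h1 := ((hp.sub (hV t)).sub (hH t)).sub ((h.noise t).mono_left hU)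
    rw [sub_zero] at h1
    exact h1.congr fun n => (h.eq_sub_sum (windowEnd_mem h.sum n t).1).symm
  have hyK : ∀ t, p - V t - H t ∈ K := fun t =>
    hK.isClosed.mem_of_tendsto (hy t) (Eventually.of_forall fun n => h.mem _)
  have h0 : p - V 0 - H 0 = p := by rw [hV.map_zero, hH.map_zero, sub_zero, sub_zero]
  refine ⟨_, hyK τ, hy τ, ?_⟩
  have h2 := lt_of_not_mem_stationarySet (y := fun t => p - V t - H t) hX hKX hK hf hreg hyK
    hVL hHL (fun t => by simp only [h0])
    (fun t ht ζ hζ => h.mem_clarkeGradient_of_hasDerivAt hX hf hU hV ht (hKX (hyK t)) (hy t) hζ)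
    (fun t ht ξ hξ => h.mem_normalConeAt_of_hasDerivAt hU hH ht (hy t) hξ)
    (by simpa only [h0] using hpS) hτ
  simpa only [h0] using h2

/-- The values of `f` cannot cross an interval upwards infinitely often if its lower end is not a
stationary value. -/
theorem not_frequently_upcrossing [FiniteDimensional ℝ E]
    (h : IsSubgradientScheme f K C γ x v η ν)
    (hX : IsOpen X) (hKX : K ⊆ X) (hK : IsCompact K) (hf : LocallyLipschitzOn X f)
    (hreg : ∀ z ∈ X, IsClarkeRegularAt f z) {c d : ℝ} (hcd : c < d)
    (hc : c ∉ f '' stationarySet f K) (hlow : ∃ᶠ n in atTop, f (x n) < c) :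
    ¬ ∃ᶠ n in atTop, d < f (x n) := by
  intro hup
  obtain ⟨L, hL⟩ := (hf.mono hKX).exists_lipschitzOnWith_of_compact hK
  have hfK : ContinuousOn f K := hL.continuousOn
  -- the last indices below `c` before a passage above `d`
  have hfreq : ∃ᶠ n in atTop, f (x n) ≤ c ∧ ∃ N, n < N ∧ d < f (x N) ∧
      ∀ k, n < k → k ≤ N → c < f (x k) := by
    rw [frequently_atTop]
    intro n₀
    obtain ⟨a, ha, hac⟩ := frequently_atTop.1 hlow n₀
    obtain ⟨N, hN, hNd⟩ := frequently_atTop.1 hup a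
    have h1 := Nat.findGreatest_spec (P := fun k => f (x k) ≤ c) hN hac.le
    have h2 := Nat.le_findGreatest (P := fun k => f (x k) ≤ c) hN hac.le
    refine ⟨Nat.findGreatest (fun k => f (x k) ≤ c) N, ha.trans h2, h1, N, ?_, hNd, ?_⟩
    · refine lt_of_le_of_ne (Nat.findGreatest_le N) fun h => ?_
      rw [h] at h1
      linarith
    · intro k hk hkN
      exact not_le.1 (Nat.findGreatest_is_greatest hk hkN)
  have hne := frequently_iff_neBot.1 hfreq
  set U := Ultrafilter.of (atTop ⊓ 𝓟 {n | f (x n) ≤ c ∧ ∃ N, n < N ∧ d < f (x N) ∧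
      ∀ k, n < k → k ≤ N → c < f (x k)})
  have hU : (U : Filter ℕ) ≤ atTop := (Ultrafilter.of_le _).trans inf_le_left
  have hUp : ∀ᶠ n in (U : Filter ℕ), f (x n) ≤ c ∧ ∃ N, n < N ∧ d < f (x N) ∧
      ∀ k, n < k → k ≤ N → c < f (x k) :=
    le_principal_iff.1 ((Ultrafilter.of_le _).trans inf_le_right)
  obtain ⟨p, hpK, hp⟩ := hK.ultrafilter_le_nhds (U.map x)
    (le_principal_iff.2 (mem_map.2 (univ_mem' h.mem)))
  have hp : Tendsto x U (𝓝 p) := hp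
  have hfx : ∀ {i : ℕ → ℕ} {q : E}, q ∈ K → Tendsto (fun n => x (i n)) U (𝓝 q) →
      Tendsto (fun n => f (x (i n))) U (𝓝 (f q)) := fun hq hi =>
    (hfK _ hq).tendsto.comp
      (tendsto_nhdsWithin_iff.2 ⟨hi, Eventually.of_forall fun n => h.mem _⟩)
  have hstep : Tendsto (fun n => x (n + 1)) U (𝓝 p) := by
    have h1 : Tendsto (fun n => x (n + 1) - x n) U (𝓝 0) := by
      refine squeeze_zero_norm (fun n => h.norm_step n) ?_
      simpa using (h.lim.mono_left hU).const_mul (C : ℝ)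
    simpa using h1.add hp
  -- `x n` lies at or below level `c` and `x (n + 1)` above it, while both tend to `p`.
  have hfp : f p = c := by
    refine le_antisymm (le_of_tendsto (hfx (i := id) hpK hp) (hUp.mono fun n hn => hn.1)) ?_
    refine ge_of_tendsto (hfx hpK hstep) (hUp.mono ?_)
    rintro n ⟨-, N, hN, -, hk⟩
    exact (hk (n + 1) (Nat.lt_succ_self n) hN).le
  have hpS : p ∉ stationarySet f K := fun hS => hc ⟨p, hS, hfp⟩
  -- With `τ` this short, `f` cannot climb from `c` to `d` within a window, so the window ends
  -- before `N`, where `f` still exceeds `c`.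
  obtain ⟨τ, hτ, hτd⟩ : ∃ τ : ℝ, 0 < τ ∧ L * (C * τ) < d - c := by
    have h1 : Tendsto (fun τ : ℝ => L * (C * τ)) (𝓝[>] 0) (𝓝 0) :=
      (Continuous.tendsto' (by fun_prop) _ _ (by simp)).mono_left nhdsWithin_le_nhds
    have h2 : ∀ᶠ τ : ℝ in 𝓝[>] 0, 0 < τ := self_mem_nhdsWithin
    exact (h2.and (h1.eventually_lt_const (sub_pos.2 hcd))).exists
  obtain ⟨q, hqK, hq, hqp⟩ := h.exists_tendsto_windowEnd_lt hX hKX hK hf hreg U hU hp hpS hτ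
  have h2 : Tendsto (fun n => L * (C * (stepTime γ (windowEnd γ n τ) - stepTime γ n))) U
      (𝓝 (L * (C * τ))) := by
    have := (tendsto_stepTime_windowEnd_sub h.sum h.lim τ).mono_left hU
    rw [max_eq_left hτ.le] at this
    exact (this.const_mul _).const_mul _
  have h3 : c ≤ f q := by
    refine ge_of_tendsto (hfx hqK hq) ?_
    filter_upwards [hUp, h2.eventually_lt_const hτd] with n hn hnτ
    obtain ⟨hnc, N, hnN, hNd, hk⟩ := hn
    obtain ⟨h4, h5⟩ := windowEnd_mem h.sum n τ
    have h6 : n < windowEnd γ n τ := by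
      refine lt_of_le_of_ne h4 fun h => ?_
      rw [← h] at h5
      linarith
    refine (hk _ h6 ?_).le
    by_contra! hlt
    have h7 := hL.dist_le_mul _ (h.mem N) _ (h.mem n)
    rw [Real.dist_eq, dist_eq_norm] at h7
    have h8 := norm_sub_le_of_step_le h.norm_step hnN.le
    have h9 := mul_le_mul_of_nonneg_left (stepTime_mono h.pos hlt.le) C.coe_nonneg
    have h10 := mul_le_mul_of_nonneg_left
      (h8.trans (by linarith : _ ≤ (C : ℝ) * (stepTime γ (windowEnd γ n τ) - stepTime γ n))) L.coe_nonneg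
    have h11 := le_abs_self (f (x N) - f (x n))
    linarith
  linarith

/-- Otherwise both `p` and a point `q` of lower value are approached infinitely often, which forces
infinitely many passages across an interval whose lower end is a nonstationary value. -/
theorem mem_stationarySet_of_tendsto [FiniteDimensional ℝ E]
    (h : IsSubgradientScheme f K C γ x v η ν)
    (hX : IsOpen X) (hKX : K ⊆ X) (hK : IsCompact K) (hf : LocallyLipschitzOn X f)
    (hreg : ∀ z ∈ X, IsClarkeRegularAt f z) (hS : interior (f '' stationarySet f K) = ∅)
    (U : Ultrafilter ℕ) (hU : (U : Filter ℕ) ≤ atTop) {p : E} (hp : Tendsto x U (𝓝 p)) :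
    p ∈ stationarySet f K := by
  by_contra hpS
  have hpK : p ∈ K := hK.isClosed.mem_of_tendsto hp (Eventually.of_forall h.mem)
  obtain ⟨q, hqK, hq, hqp⟩ := h.exists_tendsto_windowEnd_lt hX hKX hK hf hreg U hU hp hpS one_pos
  obtain ⟨c, hc, hqc, hcp⟩ : ∃ c, c ∉ f '' stationarySet f K ∧ c ∈ Set.Ioo (f q) (f p) := by
    by_contra! hcon
    have h1 : Set.Ioo (f q) (f p) ⊆ interior (f '' stationarySet f K) :=
      interior_maximal (fun c hc => by_contra fun hc' => hcon c hc' hc) isOpen_Ioo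
    rw [hS] at h1
    exact (Set.nonempty_Ioo.2 hqp).ne_empty (Set.subset_eq_empty h1 rfl)
  obtain ⟨d, hcd, hdp⟩ := exists_between hcp
  have hfK : ContinuousOn f K := hf.continuousOn.mono hKX
  have hfx : ∀ {i : ℕ → ℕ} {q : E}, q ∈ K → Tendsto (fun n => x (i n)) U (𝓝 q) →
      Tendsto (fun n => f (x (i n))) U (𝓝 (f q)) := fun hq hi =>
    (hfK _ hq).tendsto.comp
      (tendsto_nhdsWithin_iff.2 ⟨hi, Eventually.of_forall fun n => h.mem _⟩)
  refine h.not_frequently_upcrossing hX hKX hK hf hreg hcd hc ?_ ?_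
  · have h1 := ((hfx hqK hq).eventually_lt_const hqc).frequently
    exact ((tendsto_windowEnd h.sum 1).mono_left hU).frequently h1
  · exact ((hfx (i := id) hpK hp).eventually_const_lt hdp).frequently.filter_mono hU

/-- By compactness `x` converges along every ultrafilter finer than `atTop`, necessarily to a
stationary point. -/
theorem stationarySet_nonempty_and_tendsto_infDist [FiniteDimensional ℝ E]
    (h : IsSubgradientScheme f K C γ x v η ν)
    (hX : IsOpen X) (hKX : K ⊆ X) (hK : IsCompact K) (hf : LocallyLipschitzOn X f)
    (hreg : ∀ z ∈ X, IsClarkeRegularAt f z) (hS : interior (f '' stationarySet f K) = ∅) :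
    (stationarySet f K).Nonempty ∧
      Tendsto (fun k => Metric.infDist (x k) (stationarySet f K)) atTop (𝓝 0) := by
  have hlim : ∀ U : Ultrafilter ℕ, (U : Filter ℕ) ≤ atTop → ∃ p ∈ stationarySet f K,
      Tendsto x U (𝓝 p) := by
    intro U hU
    obtain ⟨p, -, hp⟩ := hK.ultrafilter_le_nhds (U.map x)
      (le_principal_iff.2 (mem_map.2 (univ_mem' h.mem)))
    exact ⟨p, h.mem_stationarySet_of_tendsto hX hKX hK hf hreg hS U hU hp, hp⟩
  refine ⟨?_, ?_⟩
  · obtain ⟨p, hp, -⟩ := hlim (Ultrafilter.of atTop) (Ultrafilter.of_le _)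
    exact ⟨p, hp⟩
  · rw [tendsto_iff_ultrafilter]
    intro U hU
    obtain ⟨p, hp, hpx⟩ := hlim U hU
    have h1 := (Metric.continuous_infDist_pt (stationarySet f K)).tendsto p |>.comp hpx
    rwa [Metric.infDist_zero_of_mem hp] at h1

end IsSubgradientScheme

end Scheme

/-! ### Reduction of the projected iteration to the scheme -/

lemma sum_range_add_two {M : Type*} [AddCommGroup M] (a : ℕ → M) (n : ℕ) :
    ∑ k ∈ Finset.range n, a (k + 2) = ∑ k ∈ Finset.Icc 1 (n + 1), a k - a 1 := by
  induction n with
  | zero => simp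
  | succ n ih =>
    rw [Finset.sum_range_succ, ih, Finset.sum_Icc_succ_top (by omega : 1 ≤ n + 1 + 1)]
    abel

theorem mainTheorem9 (d : ℕ)
    (X K : Set (EuclideanSpace ℝ (Fin d))) (f : EuclideanSpace ℝ (Fin d) → ℝ)
    (hX : IsOpen X) (hKX : K ⊆ X) (hKconv : Convex ℝ K) (hKcomp : IsCompact K)
    (hLip : LocallyLipschitzOn X f) (hreg : ∀ z ∈ X, IsClarkeRegularAt f z)
    -- step sizes (only the indices k ≥ 1 are used)
    (γ : ℕ → ℝ) (hγpos : ∀ k, 1 ≤ k → 0 < γ k)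
    (hγsum : Tendsto (fun n : ℕ => ∑ k ∈ Finset.Icc 1 n, γ k) atTop atTop)
    (hγlim : Tendsto γ atTop (𝓝 0))
    -- noise
    (δ e r : ℕ → EuclideanSpace ℝ (Fin d))
    (hδ : ∀ k, 1 ≤ k → δ k = e k + r k)
    (hr : Tendsto (fun k => ‖r k‖) atTop (𝓝 0))
    (he : ∃ s, Tendsto (fun n : ℕ => ∑ k ∈ Finset.Icc 1 n, γ k • e k) atTop (𝓝 s))
    (hδbdd : ∃ C : ℝ, ∀ k, 1 ≤ k → ‖δ k‖ ≤ C)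
    -- iterates
    (x v Y : ℕ → EuclideanSpace ℝ (Fin d)) (hx0 : x 0 ∈ X)
    (hv : ∀ k, 1 ≤ k → v k ∈ clarkeGradient f (x (k - 1)))
    (hY : ∀ k, 1 ≤ k → Y k = v k + δ k)
    (hx : ∀ k, 1 ≤ k → IsProjectionOnto K (x (k - 1) - γ k • Y k) (x k))
    (hS : interior (f '' stationarySet f K) = ∅) :
    (stationarySet f K).Nonempty ∧
      Tendsto (fun k => Metric.infDist (x k) (stationarySet f K)) atTop (𝓝 0) := by
  obtain ⟨M, hM⟩ := exists_bound_clarkeGradient hX hKX hKcomp hLip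
  obtain ⟨D, hD⟩ := hδbdd
  -- The scheme starts at `x 1`, since `x 0` may lie outside `K`; hence the shifts by one and two.
  have hxK : ∀ k, x (k + 1) ∈ K := fun k => (hx (k + 1) (by omega)).1
  have hvM : ∀ k, ‖v (k + 2)‖ ≤ M := fun k => hM _ (hxK k) _ (hv (k + 2) (by omega))
  have hM0 : 0 ≤ M := (norm_nonneg _).trans (hvM 0)
  have hD0 : 0 ≤ D := (norm_nonneg _).trans (hD 1 le_rfl)
  have hYB : ∀ k, ‖Y (k + 2)‖ ≤ M + D := fun k => by
    rw [hY _ (by omega)]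
    exact norm_add_le_of_le (hvM k) (hD _ (by omega))
  have hγ : ∀ k, 0 < γ (k + 2) := fun k => hγpos _ (by omega)
  have hproj : ∀ k, IsProjectionOnto K (x (k + 1) - γ (k + 2) • Y (k + 2)) (x (k + 2)) :=
    fun k => hx (k + 2) (by omega)
  obtain ⟨η, hη⟩ : ∃ η : ℕ → EuclideanSpace ℝ (Fin d), ∀ k, η k =
      (γ (k + 2))⁻¹ • (x (k + 1) - γ (k + 2) • Y (k + 2) - x (k + 2)) := ⟨_, fun _ => rfl⟩
  have hηγ : ∀ k, γ (k + 2) • η k = x (k + 1) - γ (k + 2) • Y (k + 2) - x (k + 2) :=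
    fun k => by rw [hη, smul_inv_smul₀ (hγ k).ne']
  have hηB : ∀ k, ‖η k‖ ≤ M + D := fun k => by
    -- The previous iterate lies in `K`, so it is a competitor in the projection: the residual is no
    -- longer than `γ (k + 2) • Y (k + 2)`.
    have h1 := (hproj k).2 _ (hxK k)
    rw [← hηγ, sub_sub_cancel_left, norm_neg, norm_smul, norm_smul (γ (k + 2)) (Y (k + 2))] at h1
    exact (le_of_mul_le_mul_left h1 (norm_pos_iff.2 (hγ k).ne')).trans (hYB k)
  have hstep : ∀ k, x (k + 2) - x (k + 1) = -(γ (k + 2) • (Y (k + 2) + η k)) := fun k => by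
    rw [smul_add, hηγ]; abel
  -- A step is bounded by `‖Y‖ + ‖η‖`, each at most `M + D`.
  have hB0 : 0 ≤ 2 * (M + D) := by positivity
  have hscheme : IsSubgradientScheme f K ⟨2 * (M + D), hB0⟩ (fun k => γ (k + 2))
      (fun k => x (k + 1)) (fun k => v (k + 2)) η (fun k => e (k + 2) + r (k + 2)) := by
    have hsum : Tendsto (stepTime fun k => γ (k + 2)) atTop atTop := by
      refine (tendsto_atTop_add_const_right _ (-γ 1)
        (hγsum.comp (tendsto_add_atTop_nat 1))).congr fun n => ?_
      rw [← sub_eq_add_neg]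
      exact (sum_range_add_two γ n).symm
    have hlim : Tendsto (fun k => γ (k + 2)) atTop (𝓝 0) :=
      hγlim.comp (tendsto_add_atTop_nat 2)
    refine ⟨hγ, hsum, hlim, hxK, fun k => hv (k + 2) (by omega), fun k z hz => ?_,
      fun k => ?_, fun k => ?_, fun k => ?_, fun k => ?_, ?_⟩
    · rw [hη, real_inner_smul_left]
      exact mul_nonpos_of_nonneg_of_nonpos (inv_nonneg.2 (hγ k).le)
        ((hproj k).inner_le_zero hKconv hz)
    · exact (hvM k).trans (by change M ≤ 2 * (M + D); linarith)
    · exact (hηB k).trans (by change M + D ≤ 2 * (M + D); linarith)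
    · change ‖x (k + 2) - x (k + 1)‖ ≤ 2 * (M + D) * γ (k + 2)
      rw [hstep, norm_neg, norm_smul, Real.norm_of_nonneg (hγ k).le, mul_comm]
      refine mul_le_mul_of_nonneg_right ?_ (hγ k).le
      exact (norm_add_le_of_le (hYB k) (hηB k)).trans_eq (by ring)
    · change x (k + 2) = x (k + 1) - γ (k + 2) • (v (k + 2) + η k + (e (k + 2) + r (k + 2)))
      rw [← hδ _ (by omega), add_right_comm, ← hY _ (by omega), sub_eq_add_neg, ← hstep]
      abel
    · obtain ⟨s, hs⟩ := he
      refine tendsto_sum_window_noise hγ hsum hlim (e := fun k => e (k + 2))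
        (r := fun k => r (k + 2)) (S := s - γ 1 • e 1) ?_ (hr.comp (tendsto_add_atTop_nat 2))
      refine ((hs.comp (tendsto_add_atTop_nat 1)).sub_const _).congr fun n => ?_
      exact (sum_range_add_two (fun k => γ k • e k) n).symm
  obtain ⟨h1, h2⟩ :=
    hscheme.stationarySet_nonempty_and_tendsto_infDist hX hKX hKcomp hLip hreg hS
  exact ⟨h1, (tendsto_add_atTop_iff_nat 1).1 h2⟩
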